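/- For a nonnegative integer $n$ with binary digits $\delta_j(n)\in\{0,1\}$, $n=\sum_{j\ge 0}\delta_j(n)2^j$, let $r(n)=\#\{j\ge 0:\delta_{j+1}(n)=\delta_j(n)=1\}$ be the number of (overlapping) occurrences of the block $11$ in the binary expansion of $n$, and let $|n|_{01}=\#\{j\ge 0:\delta_{j+1}(n)=0,\ \delta_j(n)=1\}$ be the number of maximal blocks of ones in it. Define $(v_t)_{t\ge 0}$ by $v_0=0$, $v_1=3/2$ and $$v_{4t}=v_{2t},\qquad v_{4t+2}=v_{2t+1}+1,\qquad v_{2t+1}=\frac{v_t+v_{t+1}}2+\frac34 .$$ **Theorem.** For every nonnegative integer $t$ and every integer $k$ the set $\{n\ge 0: r(n+t)-r(n)=k\}$ has an asymptotic density $c_t(k)$, that is, the limit $c_t(k)=\lim_{x\to\infty}\frac1x\#\{0\le n<x: r(n+t)-r(n)=k\}$ exists. Moreover, there are absolute constants $C$ and $N_0$, which can be taken to be nonnegative integers, such that for every nonnegative integer $t$ with $N:=|t|_{01}\ge N_0$ and for every integer $k$, $$\left|c_t(k)-\frac{1}{\sqrt{2\pi v_t}}\exp\left(-\frac{k^2}{2v_t}\right)\right|\le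 C\,\frac{(\log N)^2}{N}.$$ -/

import Mathlib

open Filter Topology

/-- `|n|_{11}`: the number of (overlapping) occurrences of the block `11` in the binary expansion
of `n`, that is, the number of `j` such that the binary digits of `n` at the places `j + 1` and `j`
are both `1`. (The digit at a place `j ≥ n` is `0`, see `mem_range_of_testBit`.) -/
def countOneOne (n : ℕ) : ℕ :=
  ((Finset.range n).filter fun j => n.testBit (j + 1) = true ∧ n.testBit j = true).card

/-- `|n|_{01}`: the number of occurrences of the block `01` in the binary expansion of `n`, padded
with `0`s to the left, that is, the number of `j` such that the binary digit of `n` at the place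
`j + 1` is `0` and the one at the place `j` is `1`. It is the number of maximal blocks of `1`s. -/
def countZeroOne (n : ℕ) : ℕ :=
  ((Finset.range n).filter fun j => n.testBit (j + 1) = false ∧ n.testBit j = true).card

/-- Restricting the places to `j < n` loses nothing. -/
theorem mem_range_of_testBit {n j : ℕ} (h : n.testBit j = true) : j ∈ Finset.range n :=
  Finset.mem_range.2 (lt_of_lt_of_le Nat.lt_two_pow_self (Nat.ge_two_pow_of_testBit h))

theorem countOneOne_eq_ncard (n : ℕ) :
    countOneOne n = {j : ℕ | n.testBit (j + 1) = true ∧ n.testBit j = true}.ncard := by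
  rw [countOneOne, ← Set.ncard_coe_finset]
  congr 1
  ext j
  simp only [Finset.coe_filter, Set.mem_ofPred_eq]
  exact ⟨fun h => h.2, fun h => ⟨mem_range_of_testBit h.2, h⟩⟩

theorem countZeroOne_eq_ncard (n : ℕ) :
    countZeroOne n = {j : ℕ | n.testBit (j + 1) = false ∧ n.testBit j = true}.ncard := by
  rw [countZeroOne, ← Set.ncard_coe_finset]
  congr 1
  ext j
  simp only [Finset.coe_filter, Set.mem_ofPred_eq]
  exact ⟨fun h => h.2, fun h => ⟨mem_range_of_testBit h.2, h⟩⟩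

/-- `d(t, n) = r(n + t) - r(n)`, an integer, where `r(n) = |n|_{11}`. -/
def blockDiff (t n : ℕ) : ℤ :=
  (countOneOne (n + t) : ℤ) - (countOneOne n : ℤ)

/-- The set `A` of nonnegative integers has an asymptotic density, and its value is `c`:
the proportion of elements of `A` among `0, …, x - 1` tends to `c` as `x → ∞`. -/
def HasAsymptoticDensity (A : Set ℕ) (c : ℝ) : Prop :=
  Tendsto (fun x : ℕ => ((A ∩ Set.Iio x).ncard : ℝ) / (x : ℝ)) atTop (𝓝 c)

/-- The sequence `v_t`: `v_0 = 0`, `v_1 = 3/2`, `v_{4t} = v_{2t}`, `v_{4t+2} = v_{2t+1} + 1`,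
`v_{2t+1} = (v_t + v_{t+1}) / 2 + 3/4`; see the lemmas below. -/
noncomputable def varianceSeq (t : ℕ) : ℝ :=
  if t = 0 then 0
  else if t = 1 then 3 / 2
  else if t % 4 = 0 then varianceSeq (t / 2)
  else if t % 4 = 2 then varianceSeq (t / 2) + 1
  else (varianceSeq (t / 2) + varianceSeq (t / 2 + 1)) / 2 + 3 / 4
termination_by t
decreasing_by all_goals omega

theorem varianceSeq_zero : varianceSeq 0 = 0 := by
  rw [varianceSeq, if_pos rfl]

theorem varianceSeq_one : varianceSeq 1 = 3 / 2 := by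
  rw [varianceSeq, if_neg one_ne_zero, if_pos rfl]

theorem varianceSeq_four_mul (t : ℕ) : varianceSeq (4 * t) = varianceSeq (2 * t) := by
  rcases Nat.eq_zero_or_pos t with rfl | ht
  · rfl
  · rw [varianceSeq, if_neg (by omega), if_neg (by omega), if_pos (by omega),
      show 4 * t / 2 = 2 * t by omega]

theorem varianceSeq_four_mul_add_two (t : ℕ) :
    varianceSeq (4 * t + 2) = varianceSeq (2 * t + 1) + 1 := by
  rw [varianceSeq, if_neg (by omega), if_neg (by omega), if_neg (by omega), if_pos (by omega),
    show (4 * t + 2) / 2 = 2 * t + 1 by omega]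

theorem varianceSeq_two_mul_add_one (t : ℕ) :
    varianceSeq (2 * t + 1) = (varianceSeq t + varianceSeq (t + 1)) / 2 + 3 / 4 := by
  rcases Nat.eq_zero_or_pos t with rfl | ht
  · simp only [mul_zero, zero_add, varianceSeq_zero, varianceSeq_one]
    norm_num
  · rw [varianceSeq, if_neg (by omega), if_neg (by omega), if_neg (by omega), if_neg (by omega),
      show (2 * t + 1) / 2 = t by omega]

/-!
If `n = 2 * m + e` and `μ` is the last digit of `m`, then `blockDiff T n` exceeds
`blockDiff ((T + e) / 2) m` by an integer that depends only on `T`, `e` and `μ`. Hence the densities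
of the level sets satisfy a linear recursion along `(T, e) ↦ ((T + e) / 2, μ)`, and so do their
characteristic functions, with coefficients of absolute value `1 / 2`.

Let `N` be the number of blocks of ones in `t`. Near the origin, one step of the recursion for the
recentered characteristic functions preserves the Gaussian shape up to `O(|θ| ^ 3)`, and a step
that produces an error also increases the variance now or at the next step. Thus the distance to
the Gaussian of variance `v_t` is `O(N * |θ| ^ 3)`. On the whole circle, each block of ones produces
two paths of the recursion that meet again with gains differing by one, and their partial
cancellation yields the bound `exp (-N * θ ^ 2 / 640)`. In the Fourier inversion formula the second
estimate leaves `O(1 / N)` beyond `θ ^ 2 = ρ := 640 * log N / N`, and the first one contributes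
`O(N * ρ ^ 2) = O((log N) ^ 2 / N)` below.
-/

/-! ### Asymptotic densities -/

theorem hasAsymptoticDensity_empty : HasAsymptoticDensity ∅ 0 := by
  simp [HasAsymptoticDensity]

theorem hasAsymptoticDensity_univ : HasAsymptoticDensity Set.univ 1 := by
  refine tendsto_const_nhds.congr' ?_
  filter_upwards [eventually_gt_atTop 0] with x hx
  rw [Set.univ_inter, ← Finset.coe_Iio, Set.ncard_coe_finset, Nat.card_Iio,
    div_self (by positivity)]

theorem mul_add_lt_iff_lt_ceilDiv {q : ℕ} (hq : 0 < q) (m r x : ℕ) :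
    q * m + r < x ↔ m < (x - r) ⌈/⌉ q := by
  rw [← not_le (b := m), ceilDiv_le_iff_le_mul hq]
  omega

theorem ncard_image_mul_add_inter_Iio {q : ℕ} (hq : 0 < q) (A : Set ℕ) (r x : ℕ) :
    ((fun m => q * m + r) '' A ∩ Set.Iio x).ncard = (A ∩ Set.Iio ((x - r) ⌈/⌉ q)).ncard := by
  rw [← Set.ncard_image_of_injective (A ∩ Set.Iio ((x - r) ⌈/⌉ q))
    (f := fun m => q * m + r) fun m n h => by simpa [hq.ne'] using h]
  congr 1
  ext n
  simp only [Set.mem_inter_iff, Set.mem_image, Set.mem_Iio, ← mul_add_lt_iff_lt_ceilDiv hq]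
  grind

theorem tendsto_sub_ceilDiv_atTop {q : ℕ} (hq : 0 < q) (r : ℕ) :
    Tendsto (fun x => (x - r) ⌈/⌉ q) atTop atTop :=
  tendsto_atTop_atTop.2 fun b => ⟨q * b + r + 1, fun x hx =>
    ((mul_add_lt_iff_lt_ceilDiv hq b r x).1 (by omega)).le⟩

theorem tendsto_sub_ceilDiv_div {q : ℕ} (hq : 0 < q) (r : ℕ) :
    Tendsto (fun x : ℕ => (((x - r) ⌈/⌉ q : ℕ) : ℝ) / x) atTop (𝓝 (1 / q)) := by
  have abs_sub_le (x : ℕ) : |(q * ((x - r) ⌈/⌉ q : ℕ) - x : ℝ)| ≤ q + r := by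
    have lower : x ≤ q * ((x - r) ⌈/⌉ q) + r :=
      not_lt.1 fun h => ((mul_add_lt_iff_lt_ceilDiv hq _ r x).1 h).false
    have upper : q * ((x - r) ⌈/⌉ q) ≤ x + q := by
      rw [Nat.ceilDiv_eq_add_pred_div]
      exact (Nat.mul_div_le _ q).trans (by omega)
    rify at lower upper
    exact abs_le.2 ⟨by linarith, by linarith [r.cast_nonneg (α := ℝ)]⟩
  refine tendsto_iff_norm_sub_tendsto_zero.2 (squeeze_zero' (.of_forall fun _ => norm_nonneg _) ?_
    (tendsto_const_nhds.div_atTop tendsto_natCast_atTop_atTop : Tendsto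
      (fun x : ℕ => ((q + r) / q : ℝ) / x) atTop (𝓝 0)))
  filter_upwards [eventually_gt_atTop 0] with x hx
  have hq_real : (0 : ℝ) < q := by exact_mod_cast hq
  have hx_real : (0 : ℝ) < x := by exact_mod_cast hx
  rw [div_sub_div _ _ hx_real.ne' hq_real.ne', Real.norm_eq_abs, abs_div,
    abs_of_pos (mul_pos hx_real hq_real), div_div, mul_comm (q : ℝ) x, mul_one, mul_comm _ (q : ℝ)]
  gcongr
  exact abs_sub_le x

namespace HasAsymptoticDensity

variable {A B : Set ℕ} {a b : ℝ}

theorem unique (ha : HasAsymptoticDensity A a) (hb : HasAsymptoticDensity A b) : a = b :=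
  tendsto_nhds_unique ha hb

theorem nonneg (hA : HasAsymptoticDensity A a) : 0 ≤ a :=
  ge_of_tendsto' hA fun _ => by positivity

theorem le_one (hA : HasAsymptoticDensity A a) : a ≤ 1 := by
  refine le_of_tendsto_of_tendsto' hA hasAsymptoticDensity_univ fun x => ?_
  gcongr
  · exact (Set.finite_Iio x).subset Set.inter_subset_right
  · exact Set.subset_univ A

theorem union (hA : HasAsymptoticDensity A a) (hB : HasAsymptoticDensity B b)
    (hAB : Disjoint A B) : HasAsymptoticDensity (A ∪ B) (a + b) := by
  refine (Tendsto.add hA hB).congr fun x => ?_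
  rw [Set.union_inter_distrib_right, Set.ncard_union_eq
    (hAB.mono Set.inter_subset_left Set.inter_subset_left)
    ((Set.finite_Iio x).subset Set.inter_subset_right)
    ((Set.finite_Iio x).subset Set.inter_subset_right), Nat.cast_add, add_div]

theorem biUnion_finset {ι : Type*} {A : ι → Set ℕ} {a : ι → ℝ} (s : Finset ι)
    (hA : ∀ i ∈ s, HasAsymptoticDensity (A i) (a i))
    (hd : Pairwise fun i j => Disjoint (A i) (A j)) :
    HasAsymptoticDensity (⋃ i ∈ s, A i) (∑ i ∈ s, a i) := by
  classical
  induction s using Finset.induction_on with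
  | empty => simpa using hasAsymptoticDensity_empty
  | insert i s hi ih =>
    rw [Finset.set_biUnion_insert, Finset.sum_insert hi]
    refine (hA i (Finset.mem_insert_self i s)).union
      (ih fun j hj => hA j (Finset.mem_insert_of_mem hj)) ?_
    exact Set.disjoint_iUnion₂_right.2 fun j hj => hd (ne_of_mem_of_not_mem hj hi).symm

theorem image_mul_add (hA : HasAsymptoticDensity A a) {q : ℕ} (hq : 0 < q) (r : ℕ) :
    HasAsymptoticDensity ((fun m => q * m + r) '' A) (a / q) := by
  have hlim := (hA.comp (tendsto_sub_ceilDiv_atTop hq r)).mul (tendsto_sub_ceilDiv_div hq r)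
  rw [mul_one_div] at hlim
  refine hlim.congr' ?_
  filter_upwards [(tendsto_sub_ceilDiv_atTop hq r).eventually (eventually_gt_atTop 0)] with x hx
  rw [Function.comp_apply, ncard_image_mul_add_inter_Iio hq,
    div_mul_div_cancel₀ (Nat.cast_ne_zero.2 hx.ne')]

theorem of_residues {q : ℕ} (hq : 0 < q) {a : Fin q → ℝ}
    (hA : ∀ r : Fin q, HasAsymptoticDensity {m | q * m + r ∈ A} (a r)) :
    HasAsymptoticDensity A ((∑ r, a r) / q) := by
  have hunion : A = ⋃ r ∈ (Finset.univ : Finset (Fin q)),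
      (fun m => q * m + (r : ℕ)) '' {m | q * m + r ∈ A} := by
    ext n
    simp only [Finset.mem_univ, Set.iUnion_true, Set.mem_iUnion, Set.mem_image, Set.mem_ofPred_eq]
    refine ⟨fun hn => ⟨⟨n % q, n.mod_lt hq⟩, n / q, ?_⟩, ?_⟩
    · simpa only [Nat.div_add_mod, and_true] using hn
    · rintro ⟨r, m, hm, rfl⟩
      exact hm
  rw [hunion, Finset.sum_div]
  refine biUnion_finset _ (fun r _ => (hA r).image_mul_add hq r) fun r s hrs => ?_
  refine Set.disjoint_image_image fun m _ n _ h => hrs (Fin.ext ?_)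
  simpa [Nat.mul_add_mod, Nat.mod_eq_of_lt] using congrArg (· % q) h

end HasAsymptoticDensity

/-! ### The effect of appending a binary digit -/

theorem ncard_testBit_pair_two_mul_add (b : Bool) (n : ℕ) (e : Fin 2) :
    {j | (2 * n + e).testBit (j + 1) = b ∧ (2 * n + e).testBit j = true}.ncard =
      {j | n.testBit (j + 1) = b ∧ n.testBit j = true}.ncard +
        if n.testBit 0 = b ∧ e = 1 then 1 else 0 := by
  set S := {j | n.testBit (j + 1) = b ∧ n.testBit j = true} with hS
  have finite_S : S.Finite :=
    (Finset.finite_toSet (Finset.range n)).subset fun j hj => mem_range_of_testBit hj.2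
  have div_two : (2 * n + e) / 2 = n := by omega
  have testBit_zero : (2 * n + e).testBit 0 = decide (e = 1) := by
    fin_cases e <;> simp
  have insert_zero : {j | (2 * n + e).testBit (j + 1) = b ∧ (2 * n + e).testBit j = true} =
      if n.testBit 0 = b ∧ e = 1 then insert 0 (Nat.succ '' S) else Nat.succ '' S := by
    ext j
    cases j <;> split_ifs with h <;> simp_all [Nat.testBit_succ]
  have zero_notMem : 0 ∉ Nat.succ '' S := by simp
  rw [insert_zero]
  split_ifs
  · rw [Set.ncard_insert_of_notMem zero_notMem (finite_S.image _),
      Set.ncard_image_of_injective _ Nat.succ_injective]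
  · rw [Set.ncard_image_of_injective _ Nat.succ_injective, add_zero]

theorem countOneOne_two_mul_add (n : ℕ) (e : Fin 2) :
    countOneOne (2 * n + e) = countOneOne n + e * (n % 2) := by
  rw [countOneOne_eq_ncard, countOneOne_eq_ncard, ncard_testBit_pair_two_mul_add]
  rcases Nat.mod_two_eq_zero_or_one n with h | h <;> fin_cases e <;> simp [Nat.testBit_zero, h]

theorem countZeroOne_two_mul_add (n : ℕ) (e : Fin 2) :
    countZeroOne (2 * n + e) = countZeroOne n + e * (1 - n % 2) := by
  rw [countZeroOne_eq_ncard, countZeroOne_eq_ncard, ncard_testBit_pair_two_mul_add]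
  rcases Nat.mod_two_eq_zero_or_one n with h | h <;> fin_cases e <;> simp [Nat.testBit_zero, h]

/-- The contribution of the last digit `e` of `2 * m + e` to `blockDiff T (2 * m + e)`, where `μ` is
the last digit of `m`. Adding `T` to `2 * m + e` leaves the digit `(T + e) % 2` and carries
`(T + e) / 2` over to `m`. -/
def digitGain (T : ℕ) (e μ : Fin 2) : ℤ :=
  (((T + e) % 2 * ((μ + (T + e) / 2) % 2) : ℕ) : ℤ) - ((e * μ : ℕ) : ℤ)

theorem blockDiff_two_mul_add (T m : ℕ) (e : Fin 2) :
    blockDiff T (2 * m + e) =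
      blockDiff ((T + e) / 2) m + digitGain T e (Fin.ofNat 2 m) := by
  have carry : 2 * m + e + T = 2 * (m + (T + e) / 2) + Fin.ofNat 2 (T + e) := by
    simp only [Fin.val_ofNat]
    omega
  rw [blockDiff, blockDiff, digitGain, carry, countOneOne_two_mul_add, countOneOne_two_mul_add,
    Fin.val_ofNat, Fin.val_ofNat, Nat.mod_add_mod]
  push_cast
  ring

theorem blockDiff_zero (n : ℕ) : blockDiff 0 n = 0 :=
  sub_self _

theorem blockDiff_one_le (n : ℕ) : blockDiff 1 n ≤ 1 := by
  induction n using Nat.evenOddRec with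
  | h0 => decide
  | h_even m _ =>
    have hgain : ∀ μ, digitGain 1 0 μ ≤ 1 := by decide
    have h := blockDiff_two_mul_add 1 m 0
    rw [show (1 + ((0 : Fin 2) : ℕ)) / 2 = 0 from rfl, blockDiff_zero, zero_add] at h
    exact h.trans_le (hgain _)
  | h_odd m ih =>
    have hgain : ∀ μ, digitGain 1 1 μ ≤ 0 := by decide
    exact (blockDiff_two_mul_add 1 m 1).trans_le (add_le_of_le_of_nonpos ih (hgain _))

/-! ### Densities of the level sets -/

theorem hasAsymptoticDensity_blockDiff_recurrence {T : ℕ} {e : Fin 2} {k : ℤ} {a : Fin 2 → ℝ}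
    (ha : ∀ μ : Fin 2, HasAsymptoticDensity
      {m | blockDiff ((T + e) / 2) (2 * m + μ) = k - digitGain T e μ} (a μ)) :
    HasAsymptoticDensity {m | blockDiff T (2 * m + e) = k} ((∑ μ, a μ) / 2) := by
  refine HasAsymptoticDensity.of_residues (q := 2) two_pos fun μ => ?_
  convert ha μ using 3 with m
  have hμ : Fin.ofNat 2 (2 * m + μ) = μ := Fin.ext (by simp only [Fin.val_ofNat]; omega)
  rw [Set.mem_ofPred_eq, blockDiff_two_mul_add, hμ, eq_sub_iff_add_eq]

theorem hasAsymptoticDensity_blockDiff_zero (e : Fin 2) (k : ℤ) :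
    HasAsymptoticDensity {m | blockDiff 0 (2 * m + e) = k} (if k = 0 then 1 else 0) := by
  simp only [blockDiff_zero]
  split_ifs with hk
  · simpa [hk] using hasAsymptoticDensity_univ
  · simpa [Ne.symm hk] using hasAsymptoticDensity_empty

-- For `T = 1` and `e = 1` the recurrence refers to the same `T` and `e`, with `k` raised by one;
-- the descent starts at `k = 2`, where the level sets are empty.
theorem exists_hasAsymptoticDensity_blockDiff_one_one (k : ℤ) :
    ∃ c, HasAsymptoticDensity {m | blockDiff 1 (2 * m + 1) = k} c := by
  have vanish {l : ℤ} (hl : 2 ≤ l) :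
      HasAsymptoticDensity {m | blockDiff 1 (2 * m + 1) = l} 0 := by
    convert hasAsymptoticDensity_empty using 1
    exact Set.eq_empty_iff_forall_notMem.2 fun m hm => by
      have := blockDiff_one_le (2 * m + 1)
      have : blockDiff 1 (2 * m + 1) = l := hm
      omega
  induction k using Int.inductionOn' (b := 2) with
  | zero => exact ⟨0, vanish le_rfl⟩
  | succ k hk _ => exact ⟨0, vanish (by omega)⟩
  | pred k _ ih =>
    have level : ∀ μ : Fin 2,
        ∃ c, HasAsymptoticDensity {m | blockDiff 1 (2 * m + μ) = k - 1 - digitGain 1 1 μ} c :=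
      Fin.forall_fin_two.2
        ⟨⟨_, hasAsymptoticDensity_blockDiff_recurrence (T := 1) (e := 0)
            fun μ => hasAsymptoticDensity_blockDiff_zero μ _⟩,
          by simpa [digitGain] using ih⟩
    choose c hc using level
    exact ⟨_, hasAsymptoticDensity_blockDiff_recurrence (T := 1) (e := 1) hc⟩

theorem exists_hasAsymptoticDensity_blockDiff (T : ℕ) (e : Fin 2) (k : ℤ) :
    ∃ c, HasAsymptoticDensity {m | blockDiff T (2 * m + e) = k} c := by
  induction T using Nat.strong_induction_on generalizing e k with
  | _ T ih =>
    rcases Nat.eq_zero_or_pos T with rfl | hT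
    · exact ⟨_, hasAsymptoticDensity_blockDiff_zero e k⟩
    by_cases hlt : (T + e) / 2 < T
    · choose c hc using fun μ : Fin 2 => ih _ hlt μ (k - digitGain T e μ)
      exact ⟨_, hasAsymptoticDensity_blockDiff_recurrence hc⟩
    obtain ⟨rfl, rfl⟩ : T = 1 ∧ e = 1 := by omega
    exact exists_hasAsymptoticDensity_blockDiff_one_one k

/-- The density `condDensity T e k` of the set of `m` with `blockDiff T (2 * m + e) = k`, that is,
the limiting probability that `blockDiff T n = k`, conditional on `e` being the last digit of
`n`. -/
noncomputable def condDensity (T : ℕ) (e : Fin 2) (k : ℤ) : ℝ :=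
  (exists_hasAsymptoticDensity_blockDiff T e k).choose

theorem hasAsymptoticDensity_condDensity (T : ℕ) (e : Fin 2) (k : ℤ) :
    HasAsymptoticDensity {m | blockDiff T (2 * m + e) = k} (condDensity T e k) :=
  (exists_hasAsymptoticDensity_blockDiff T e k).choose_spec

theorem condDensity_recurrence (T : ℕ) (e : Fin 2) (k : ℤ) :
    condDensity T e k = (∑ μ, condDensity ((T + e) / 2) μ (k - digitGain T e μ)) / 2 :=
  (hasAsymptoticDensity_condDensity T e k).unique
    (hasAsymptoticDensity_blockDiff_recurrence fun _ => hasAsymptoticDensity_condDensity _ _ _)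

theorem condDensity_zero (e : Fin 2) (k : ℤ) : condDensity 0 e k = if k = 0 then 1 else 0 :=
  (hasAsymptoticDensity_condDensity 0 e k).unique (hasAsymptoticDensity_blockDiff_zero e k)

theorem condDensity_nonneg (T : ℕ) (e : Fin 2) (k : ℤ) : 0 ≤ condDensity T e k :=
  (hasAsymptoticDensity_condDensity T e k).nonneg

theorem sum_condDensity_le_one (T : ℕ) (e : Fin 2) (s : Finset ℤ) :
    ∑ k ∈ s, condDensity T e k ≤ 1 :=
  (HasAsymptoticDensity.biUnion_finset s (fun k _ => hasAsymptoticDensity_condDensity T e k)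
    fun _ _ hkl => Set.disjoint_left.2 fun _ hk hl => hkl (hk.symm.trans hl)).le_one

theorem summable_condDensity (T : ℕ) (e : Fin 2) : Summable (condDensity T e) :=
  summable_of_sum_le (condDensity_nonneg T e) (sum_condDensity_le_one T e)

theorem tsum_condDensity_le_one (T : ℕ) (e : Fin 2) : ∑' k, condDensity T e k ≤ 1 :=
  (summable_condDensity T e).tsum_le_of_sum_le (sum_condDensity_le_one T e)

/-- The asymptotic density `c_t(k)` of the set of `n` with `blockDiff t n = k`. -/
noncomputable def diffDensity (t : ℕ) (k : ℤ) : ℝ :=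
  (∑ e, condDensity t e k) / 2

theorem summable_diffDensity (t : ℕ) : Summable (diffDensity t) :=
  (summable_sum fun e _ => summable_condDensity t e).div_const 2

theorem hasAsymptoticDensity_diffDensity (t : ℕ) (k : ℤ) :
    HasAsymptoticDensity {n | blockDiff t n = k} (diffDensity t k) :=
  .of_residues (q := 2) two_pos fun e => hasAsymptoticDensity_condDensity t e k

/-! ### Characteristic functions on the integers -/

open scoped Real

/-- The characteristic function `θ ↦ ∑ k, p k * exp (i * k * θ)` of a summable family `p` of masses
at the integers. -/
noncomputable def charSeries (p : ℤ → ℝ) (θ : ℝ) : ℂ :=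
  ∑' k : ℤ, (p k : ℂ) * Circle.exp (k * θ)

theorem norm_ofReal_mul_circle (x : ℝ) (z : Circle) : ‖(x : ℂ) * z‖ = |x| := by
  rw [norm_mul, Circle.norm_coe, mul_one, Complex.norm_real, Real.norm_eq_abs]

theorem charSeries_shift (p : ℤ → ℝ) (g : ℤ) (θ : ℝ) :
    charSeries (fun k => p (k - g)) θ = Circle.exp (g * θ) * charSeries p θ := by
  rw [charSeries, charSeries, ← tsum_mul_left, ← (Equiv.addRight g).tsum_eq]
  refine tsum_congr fun k => ?_
  rw [Equiv.coe_addRight, add_sub_cancel_right, Int.cast_add, add_mul, Circle.exp_add,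
    Circle.coe_mul]
  ring

theorem integral_circleExp_intCast_mul (n : ℤ) :
    ∫ θ in -π..π, (Circle.exp (n * θ) : ℂ) = if n = 0 then 2 * (π : ℂ) else 0 := by
  split_ifs with hn
  · simp [hn, two_mul]
  · have hc : (n * Complex.I : ℂ) ≠ 0 := mul_ne_zero (by exact_mod_cast hn) Complex.I_ne_zero
    have periodic : Complex.exp (n * Complex.I * π) = Complex.exp (n * Complex.I * (-π : ℝ)) :=
      Complex.exp_eq_exp_iff_exists_int.2 ⟨n, by push_cast; ring⟩
    simp only [Circle.coe_exp, Complex.ofReal_mul, Complex.ofReal_intCast,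
      mul_right_comm _ _ Complex.I]
    rw [integral_exp_mul_complex hc, periodic, sub_self, zero_div]

section charSeries

variable {p : ℤ → ℝ} (hp : Summable p)

include hp

theorem summable_mul_circleExp (φ : ℤ → ℝ) :
    Summable fun k : ℤ => (p k : ℂ) * Circle.exp (φ k) :=
  .of_norm (by simpa only [norm_ofReal_mul_circle] using hp.abs)

theorem continuous_charSeries : Continuous (charSeries p) :=
  continuous_tsum (u := fun k => |p k|) (fun k => by fun_prop) hp.abs
    fun k θ => (norm_ofReal_mul_circle _ _).le

theorem norm_charSeries_le (θ : ℝ) : ‖charSeries p θ‖ ≤ ∑' k, |p k| := by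
  simpa only [charSeries, norm_ofReal_mul_circle] using
    norm_tsum_le_tsum_norm (summable_mul_circleExp hp fun k => k * θ).norm

theorem hasSum_charSeries_mul (k : ℤ) (θ : ℝ) :
    HasSum (fun j : ℤ => (p j : ℂ) * Circle.exp ((j - k : ℤ) * θ))
      (charSeries p θ * Circle.exp (-(k * θ))) := by
  have h := (summable_mul_circleExp hp fun j => j * θ).hasSum.mul_right
    (Circle.exp (-(k * θ)) : ℂ)
  simpa only [charSeries, mul_assoc, ← Circle.coe_mul, ← Circle.exp_add, ← sub_eq_add_neg,
    ← sub_mul, ← Int.cast_sub] using h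

theorem integral_charSeries_mul (k : ℤ) :
    ∫ θ in -π..π, charSeries p θ * Circle.exp (-(k * θ)) = 2 * π * p k := by
  have integral_sum := intervalIntegral.hasSum_integral_of_dominated_convergence
    (μ := MeasureTheory.volume) (a := -π) (b := π)
    (F := fun (j : ℤ) (θ : ℝ) => (p j : ℂ) * Circle.exp ((j - k : ℤ) * θ))
    (f := fun θ => charSeries p θ * Circle.exp (-(k * θ)))
    (fun j _ => |p j|)
    (fun j => Continuous.aestronglyMeasurable (by fun_prop))
    (fun j => .of_forall fun θ _ => (norm_ofReal_mul_circle _ _).le)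
    (.of_forall fun θ _ => hp.abs)
    intervalIntegrable_const
    (.of_forall fun θ _ => hasSum_charSeries_mul hp k θ)
  simp only [intervalIntegral.integral_const_mul, integral_circleExp_intCast_mul] at integral_sum
  rw [integral_sum.unique (hasSum_single k fun j hj => by rw [if_neg (sub_ne_zero.2 hj), mul_zero]),
    sub_self, if_pos rfl, mul_comm]

end charSeries

theorem charSeries_average {ι : Type*} [Fintype ι] {p : ι → ℤ → ℝ} (hp : ∀ i, Summable (p i))
    (g : ι → ℤ) (c θ : ℝ) :
    charSeries (fun k => (∑ i, p i (k - g i)) / c) θ =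
      (∑ i, Circle.exp (g i * θ) * charSeries (p i) θ) / c := by
  have summable_shift (i : ι) : Summable fun k : ℤ => p i (k - g i) :=
    (Equiv.subRight (g i)).summable_iff.2 (hp i)
  simp only [← charSeries_shift]
  simp only [charSeries]
  rw [← Summable.tsum_finsetSum fun i _ => summable_mul_circleExp (summable_shift i) _,
    ← tsum_div_const]
  refine tsum_congr fun k => ?_
  push_cast
  rw [div_mul_eq_mul_div, Finset.sum_mul]

/-! ### Fourier inversion and the local limit estimate -/

theorem two_pi_mul_gaussian_eq_integral {v : ℝ} (hv : 0 < v) (x : ℝ) :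
    ((2 * π * ((√(2 * π * v))⁻¹ * Real.exp (-(x ^ 2 / (2 * v)))) : ℝ) : ℂ) =
      ∫ θ : ℝ, (Real.exp (-(v * θ ^ 2 / 2)) : ℂ) * Circle.exp (-(x * θ)) := by
  have fourier := fourierIntegral_gaussian (b := ((v / 2 : ℝ) : ℂ))
    (by rw [Complex.ofReal_re]; positivity) (-x)
  have integrand (θ : ℝ) : (Real.exp (-(v * θ ^ 2 / 2)) : ℂ) * Circle.exp (-(x * θ)) =
      Complex.exp (Complex.I * (-x) * θ) * Complex.exp (-((v / 2 : ℝ) : ℂ) * (θ : ℂ) ^ 2) := by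
    rw [Circle.coe_exp, mul_comm]
    push_cast
    ring_nf
  have prefactor : ((π : ℂ) / ((v / 2 : ℝ) : ℂ)) ^ (1 / 2 : ℂ) =
      ((2 * π * (√(2 * π * v))⁻¹ : ℝ) : ℂ) := by
    have hsqrt : √(π / (v / 2)) = 2 * π * (√(2 * π * v))⁻¹ := by
      rw [Real.sqrt_eq_iff_mul_self_eq_of_pos (by positivity), mul_mul_mul_comm, ← mul_inv,
        Real.mul_self_sqrt (by positivity)]
      field_simp
    rw [← hsqrt, Real.sqrt_eq_rpow, Complex.ofReal_cpow (by positivity)]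
    norm_num
  have exponent : -(-(x : ℂ)) ^ 2 / (4 * ((v / 2 : ℝ) : ℂ)) = ((-(x ^ 2 / (2 * v)) : ℝ) : ℂ) := by
    have : (v : ℂ) ≠ 0 := by exact_mod_cast hv.ne'
    push_cast
    field_simp
    ring
  rw [funext integrand, fourier, prefactor, exponent, ← Complex.ofReal_exp, ← Complex.ofReal_mul,
    ← mul_assoc]

theorem integrable_gaussian_mul_circleExp {v : ℝ} (hv : 0 < v) (x : ℝ) :
    MeasureTheory.Integrable fun θ : ℝ =>
      (Real.exp (-(v * θ ^ 2 / 2)) : ℂ) * Circle.exp (-(x * θ)) := by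
  refine (integrable_exp_neg_mul_sq (half_pos hv)).mono'
    (Continuous.aestronglyMeasurable (by fun_prop)) (.of_forall fun θ => ?_)
  rw [norm_ofReal_mul_circle, Real.abs_exp]
  exact (congrArg Real.exp (by ring)).le

theorem norm_setIntegral_compl_gaussian_le {v R : ℝ} (hv : 0 < v) (hR : 0 ≤ R) (x : ℝ) :
    ‖∫ θ in (Set.Ioc (-R) R)ᶜ, (Real.exp (-(v * θ ^ 2 / 2)) : ℂ) * Circle.exp (-(x * θ))‖ ≤
      Real.exp (-(v * R ^ 2 / 4)) * √(π / (v / 4)) := by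
  have integrable_bound : MeasureTheory.Integrable fun θ : ℝ =>
      Real.exp (-(v * R ^ 2 / 4)) * Real.exp (-(v / 4) * θ ^ 2) :=
    (integrable_exp_neg_mul_sq (by positivity)).const_mul _
  rw [← integral_gaussian, ← MeasureTheory.integral_const_mul,
    ← MeasureTheory.integral_indicator measurableSet_Ioc.compl]
  refine MeasureTheory.norm_integral_le_of_norm_le integrable_bound (.of_forall fun θ => ?_)
  by_cases hθ : θ ∈ Set.Ioc (-R) R
  · rw [Set.indicator_of_notMem (Set.notMem_compl_iff.2 hθ), norm_zero]
    positivity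
  have sq_le : R ^ 2 ≤ θ ^ 2 := by
    rw [Set.mem_Ioc, not_and_or, not_lt, not_le] at hθ
    rcases hθ with h | h <;> nlinarith
  rw [Set.indicator_of_mem (Set.mem_compl hθ), norm_ofReal_mul_circle, Real.abs_exp,
    ← Real.exp_add]
  exact Real.exp_le_exp.2 (by nlinarith)

theorem norm_intervalIntegral_le_of_norm_le {E : Type*} [NormedAddCommGroup E] [NormedSpace ℝ E]
    {f : ℝ → E} {r R a b : ℝ} (hr : 0 ≤ r) (hR : 0 ≤ R) (hb : 0 ≤ b)
    (ha : ∀ θ, |θ| ≤ r → ‖f θ‖ ≤ a) (hf : ∀ θ, r < |θ| → |θ| ≤ R → ‖f θ‖ ≤ b) :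
    ‖∫ θ in -R..R, f θ‖ ≤ 2 * r * a + 2 * R * b := by
  have ha₀ : 0 ≤ a := (norm_nonneg _).trans (ha 0 (by simpa using hr))
  have integrable_inner : MeasureTheory.Integrable ((Set.Icc (-r) r).indicator fun _ : ℝ => a) :=
    (MeasureTheory.integrable_indicator_iff measurableSet_Icc).2
      (MeasureTheory.integrableOn_const (by simp))
  have integrable_outer : MeasureTheory.Integrable ((Set.Ioc (-R) R).indicator fun _ : ℝ => b) :=
    (MeasureTheory.integrable_indicator_iff measurableSet_Ioc).2
      (MeasureTheory.integrableOn_const (by simp))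
  have integral_bound : ∫ θ, ((Set.Icc (-r) r).indicator (fun _ => a) θ +
      (Set.Ioc (-R) R).indicator (fun _ => b) θ) = 2 * r * a + 2 * R * b := by
    rw [MeasureTheory.integral_add integrable_inner integrable_outer,
      MeasureTheory.integral_indicator_const _ measurableSet_Icc,
      MeasureTheory.integral_indicator_const _ measurableSet_Ioc,
      Real.volume_real_Icc_of_le (by linarith), Real.volume_real_Ioc_of_le (by linarith)]
    simp only [smul_eq_mul]
    ring
  rw [intervalIntegral.integral_of_le (by linarith),
    ← MeasureTheory.integral_indicator measurableSet_Ioc, ← integral_bound]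
  refine MeasureTheory.norm_integral_le_of_norm_le (integrable_inner.add integrable_outer)
    (.of_forall fun θ => ?_)
  have inner_nonneg : 0 ≤ (Set.Icc (-r) r).indicator (fun _ => a) θ :=
    Set.indicator_nonneg (fun _ _ => ha₀) θ
  by_cases hθ : θ ∈ Set.Ioc (-R) R
  · rw [Set.indicator_of_mem hθ, Set.indicator_of_mem hθ]
    rcases le_or_gt |θ| r with h | h
    · rw [Set.indicator_of_mem (Set.mem_Icc.2 (abs_le.1 h))]
      exact (ha θ h).trans (le_add_of_nonneg_right hb)
    · exact (hf θ h (abs_le.2 ⟨hθ.1.le, hθ.2⟩)).trans (le_add_of_nonneg_left inner_nonneg)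
  · rw [Set.indicator_of_notMem hθ, Set.indicator_of_notMem hθ, norm_zero, add_zero]
    exact inner_nonneg

theorem abs_sub_gaussian_le_of_norm_charSeries_sub_le {p : ℤ → ℝ} (hp : Summable p)
    {v r a b : ℝ} (hv : 0 < v) (hr : 0 ≤ r) (hb : 0 ≤ b)
    (hinner : ∀ θ : ℝ, |θ| ≤ r → ‖charSeries p θ - Real.exp (-(v * θ ^ 2 / 2))‖ ≤ a)
    (houter : ∀ θ : ℝ, r < |θ| → |θ| ≤ π →
      ‖charSeries p θ - Real.exp (-(v * θ ^ 2 / 2))‖ ≤ b) (k : ℤ) :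
    |p k - (√(2 * π * v))⁻¹ * Real.exp (-((k : ℝ) ^ 2 / (2 * v)))| ≤
      (2 * r * a + 2 * π * b + Real.exp (-(v * π ^ 2 / 4)) * √(π / (v / 4))) / (2 * π) := by
  set z : ℝ → Circle := fun θ => Circle.exp (-(k * θ))
  have integrable_gaussian := integrable_gaussian_mul_circleExp hv k
  have split : ((2 * π * (p k - (√(2 * π * v))⁻¹ * Real.exp (-((k : ℝ) ^ 2 / (2 * v)))) : ℝ) : ℂ) =
      (∫ θ in -π..π, (charSeries p θ - Real.exp (-(v * θ ^ 2 / 2))) * z θ) -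
        ∫ θ in (Set.Ioc (-π) π)ᶜ, (Real.exp (-(v * θ ^ 2 / 2)) : ℂ) * z θ := by
    have integrable_charSeries : IntervalIntegrable (fun θ => charSeries p θ * z θ)
        MeasureTheory.volume (-π) π :=
      ((continuous_charSeries hp).mul (by fun_prop)).intervalIntegrable _ _
    simp only [sub_mul]
    rw [intervalIntegral.integral_sub integrable_charSeries integrable_gaussian.intervalIntegrable,
      integral_charSeries_mul hp, intervalIntegral.integral_of_le (by linarith [Real.pi_pos]),
      sub_sub, MeasureTheory.integral_add_compl measurableSet_Ioc integrable_gaussian,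
      ← two_pi_mul_gaussian_eq_integral hv]
    push_cast
    ring
  rw [le_div_iff₀' Real.two_pi_pos, ← abs_of_pos Real.two_pi_pos, ← abs_mul,
    abs_of_pos Real.two_pi_pos, ← Real.norm_eq_abs, ← Complex.norm_real, split]
  refine (norm_sub_le _ _).trans (add_le_add (norm_intervalIntegral_le_of_norm_le hr Real.pi_pos.le
    hb ?_ ?_) (norm_setIntegral_compl_gaussian_le hv Real.pi_pos.le k))
  · simpa only [norm_mul, Circle.norm_coe, mul_one] using hinner
  · simpa only [norm_mul, Circle.norm_coe, mul_one] using houter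

/-! ### Decay of the characteristic functions -/

/-- The characteristic function of the masses `condDensity T e`. -/
noncomputable def condChar (T : ℕ) (e : Fin 2) : ℝ → ℂ :=
  charSeries (condDensity T e)

theorem condChar_recurrence (T : ℕ) (e : Fin 2) (θ : ℝ) :
    condChar T e θ =
      (∑ μ, Circle.exp (digitGain T e μ * θ) * condChar ((T + e) / 2) μ θ) / 2 := by
  have h := charSeries_average (fun μ => summable_condDensity ((T + e) / 2) μ) (digitGain T e) 2 θ
  simpa only [condChar, ← condDensity_recurrence, Complex.ofReal_ofNat] using h

theorem condChar_zero (e : Fin 2) (θ : ℝ) : condChar 0 e θ = 1 := by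
  rw [condChar, charSeries, tsum_eq_single 0 fun k hk => by simp [condDensity_zero, hk]]
  simp [condDensity_zero]

theorem norm_condChar_le_one (T : ℕ) (e : Fin 2) (θ : ℝ) : ‖condChar T e θ‖ ≤ 1 := by
  refine (norm_charSeries_le (summable_condDensity T e) θ).trans ?_
  simpa only [abs_of_nonneg (condDensity_nonneg T e _)] using tsum_condDensity_le_one T e

/-- The pair reached from `(T, e)` after reading the digits `w 0, …, w (n - 1)`, where reading `μ`
moves `(T, e)` to `((T + e) / 2, μ)` as in `blockDiff_two_mul_add`. -/
def pathEnd : {n : ℕ} → ℕ → Fin 2 → (Fin n → Fin 2) → ℕ × Fin 2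
  | 0, T, e, _ => (T, e)
  | _ + 1, T, e, w => pathEnd ((T + e) / 2) (w 0) (Fin.tail w)

/-- The sum of the digit gains along the path of `pathEnd`. -/
def pathGain : {n : ℕ} → ℕ → Fin 2 → (Fin n → Fin 2) → ℤ
  | 0, _, _, _ => 0
  | _ + 1, T, e, w => digitGain T e (w 0) + pathGain ((T + e) / 2) (w 0) (Fin.tail w)

theorem condChar_eq_sum_path (n T : ℕ) (e : Fin 2) (θ : ℝ) :
    condChar T e θ = (∑ w : Fin n → Fin 2, Circle.exp (pathGain T e w * θ) *
      condChar (pathEnd T e w).1 (pathEnd T e w).2 θ) / 2 ^ n := by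
  induction n generalizing T e with
  | zero => simp [pathGain, pathEnd]
  | succ n ih =>
    rw [condChar_recurrence, ← (Fin.consEquiv fun _ : Fin (n + 1) => Fin 2).sum_comp,
      Fintype.sum_prod_type, pow_succ, ← div_div]
    congr 1
    rw [Finset.sum_div]
    refine Finset.sum_congr rfl fun μ _ => ?_
    rw [ih ((T + e) / 2) μ, mul_div_assoc', Finset.mul_sum]
    congr 1
    refine Finset.sum_congr rfl fun w _ => ?_
    have tail_cons : Fin.tail ((Fin.consEquiv fun _ : Fin (n + 1) => Fin 2) (μ, w)) = w := rfl
    simp only [pathGain, pathEnd, tail_cons, Fin.consEquiv_apply, Fin.cons_zero, Int.cast_add,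
      add_mul, Circle.exp_add, Circle.coe_mul, mul_assoc]

theorem pathEnd_add_two_pow_mul {n : ℕ} (T u : ℕ) (e : Fin 2) (w : Fin n → Fin 2) :
    pathEnd (T + 2 ^ n * u) e w = ((pathEnd T e w).1 + u, (pathEnd T e w).2) := by
  induction n generalizing T e with
  | zero => simp [pathEnd]
  | succ n ih =>
    rw [pathEnd, pathEnd, ← ih, show (T + 2 ^ (n + 1) * u + e) / 2 = (T + e) / 2 + 2 ^ n * u by
      rw [pow_succ', mul_assoc]; omega]

theorem digitGain_add_four_mul (T u : ℕ) (e μ : Fin 2) :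
    digitGain (T + 4 * u) e μ = digitGain T e μ := by
  rw [digitGain, digitGain, show (T + 4 * u + e) % 2 = (T + e) % 2 by omega,
    show (μ + (T + 4 * u + e) / 2) % 2 = (μ + (T + e) / 2 : ℕ) % 2 by omega]

theorem pathGain_add_two_pow_mul {n : ℕ} (T u : ℕ) (e : Fin 2) (w : Fin n → Fin 2) :
    pathGain (T + 2 ^ (n + 1) * u) e w = pathGain T e w := by
  induction n generalizing T e with
  | zero => rfl
  | succ n ih =>
    rw [pathGain, pathGain, show 2 ^ (n + 1 + 1) * u = 4 * (2 ^ n * u) by ring,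
      digitGain_add_four_mul, ← ih ((T + e) / 2), show (T + 4 * (2 ^ n * u) + e) / 2 =
        (T + e) / 2 + 2 ^ (n + 1) * u by rw [pow_succ', mul_assoc]; omega]

theorem pathEnd_fst_mem_Icc {n t T : ℕ} (hT : T ∈ Set.Icc t (t + 1)) (e : Fin 2)
    (w : Fin n → Fin 2) : (pathEnd T e w).1 ∈ Set.Icc (t / 2 ^ n) (t / 2 ^ n + 1) := by
  induction n generalizing t T e with
  | zero => simpa [pathEnd] using hT
  | succ n ih =>
    rw [pow_succ', ← Nat.div_div_eq_div_mul]
    rw [Set.mem_Icc] at hT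
    exact ih (Set.mem_Icc.2 (by omega)) _ _

-- The two paths `p` and `q` are where the decay comes from: their contributions to `condChar T e θ`
-- differ by the factor `exp (iθ)`, so that they partially cancel.
theorem exists_pathGain_eq_add_one_of_lt :
    ∀ T : Fin 32, (T : ℕ) % 4 = 1 ∨ (T : ℕ) % 4 = 2 → ∀ e : Fin 2, ∃ p q : Fin 4 → Fin 2,
      p ≠ q ∧ pathEnd T e p = pathEnd T e q ∧ pathGain T e p = pathGain T e q + 1 := by
  decide +kernel

theorem exists_pathGain_eq_add_one {T : ℕ} (hT : T % 4 = 1 ∨ T % 4 = 2) (e : Fin 2) :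
    ∃ p q : Fin 4 → Fin 2, p ≠ q ∧ pathEnd T e p = pathEnd T e q ∧
      pathGain T e p = pathGain T e q + 1 := by
  obtain ⟨p, q, hpq, hend, hgain⟩ := exists_pathGain_eq_add_one_of_lt
    ⟨T % 32, T.mod_lt (by norm_num)⟩ (by dsimp only; omega) e
  refine ⟨p, q, hpq, ?_, ?_⟩
  · rw [← Nat.mod_add_div T 32, show 32 * (T / 32) = 2 ^ 4 * (2 * (T / 32)) by ring,
      pathEnd_add_two_pow_mul, pathEnd_add_two_pow_mul, hend]
  · rw [← Nat.mod_add_div T 32, show 32 = 2 ^ (4 + 1) by norm_num,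
      pathGain_add_two_pow_mul, pathGain_add_two_pow_mul]
    exact hgain

theorem norm_sum_le_of_norm_add_le {ι E : Type*} [Fintype ι] [SeminormedAddCommGroup E]
    {z : ι → E} {p q : ι} {M b : ℝ} (hz : ∀ i, ‖z i‖ ≤ M) (hpq : p ≠ q)
    (hb : ‖z p + z q‖ ≤ 2 * M - b) : ‖∑ i, z i‖ ≤ Fintype.card ι * M - b := by
  classical
  have hrest : ‖∑ i ∈ {p, q}ᶜ, z i‖ ≤ (Fintype.card ι - 2) * M := by
    refine (norm_sum_le_of_le _ fun i _ => hz i).trans (le_of_eq ?_)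
    have hcard := Finset.card_add_card_compl {p, q}
    rw [Finset.card_pair hpq] at hcard
    rw [Finset.sum_const, nsmul_eq_mul, ← hcard]
    push_cast
    ring
  rw [← Finset.sum_add_sum_compl {p, q}, Finset.sum_pair hpq]
  linarith [norm_add_le (z p + z q) (∑ i ∈ {p, q}ᶜ, z i)]

theorem norm_one_add_circleExp_le {θ : ℝ} (hθ : |θ| ≤ π) :
    ‖1 + (Circle.exp θ : ℂ)‖ ≤ 2 - θ ^ 2 / 10 := by
  have hπ : π ^ 2 ≤ 10 := by nlinarith [Real.pi_lt_d2, Real.pi_pos]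
  have hθ_sq : θ ^ 2 ≤ 10 := (sq_le_sq.2 (hθ.trans_eq (abs_of_pos Real.pi_pos).symm)).trans hπ
  have hcos : Real.cos θ ≤ 1 - θ ^ 2 / 5 := by
    refine (Real.cos_le_one_sub_mul_cos_sq hθ).trans ?_
    have : 1 / 5 ≤ 2 / π ^ 2 := by
      rw [div_le_div_iff₀ (by norm_num) (by positivity)]
      linarith
    nlinarith [sq_nonneg θ]
  have hsq : ‖1 + (Circle.exp θ : ℂ)‖ ^ 2 = 2 + 2 * Real.cos θ := by
    rw [Circle.coe_exp, Complex.sq_norm, Complex.normSq_add, Complex.normSq_eq_norm_sq,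
      Complex.normSq_eq_norm_sq, Complex.norm_exp_ofReal_mul_I]
    simp [Complex.exp_ofReal_mul_I_re]
    ring
  refine abs_le_of_sq_le_sq' ?_ (by linarith) |>.2
  nlinarith [sq_nonneg (θ ^ 2)]

theorem norm_condChar_le_of_pathEnd {T : ℕ} (hT : T % 4 = 1 ∨ T % 4 = 2) (e : Fin 2) {θ M : ℝ}
    (hθ : |θ| ≤ π) (hM : ∀ w : Fin 4 → Fin 2,
      ‖condChar (pathEnd T e w).1 (pathEnd T e w).2 θ‖ ≤ M) :
    ‖condChar T e θ‖ ≤ (1 - θ ^ 2 / 160) * M := by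
  obtain ⟨p, q, hpq, hend, hgain⟩ := exists_pathGain_eq_add_one hT e
  have pair_le : ‖Circle.exp (pathGain T e p * θ) *
        condChar (pathEnd T e p).1 (pathEnd T e p).2 θ +
      Circle.exp (pathGain T e q * θ) * condChar (pathEnd T e q).1 (pathEnd T e q).2 θ‖ ≤
      2 * M - θ ^ 2 / 10 * M := by
    have factor : Circle.exp (pathGain T e p * θ) *
          condChar (pathEnd T e p).1 (pathEnd T e p).2 θ +
        Circle.exp (pathGain T e q * θ) * condChar (pathEnd T e q).1 (pathEnd T e q).2 θ =
        Circle.exp (pathGain T e q * θ) * (1 + Circle.exp θ) *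
          condChar (pathEnd T e q).1 (pathEnd T e q).2 θ := by
      rw [hend, hgain, Int.cast_add, Int.cast_one, add_mul, one_mul, Circle.exp_add,
        Circle.coe_mul]
      ring
    rw [factor, norm_mul, norm_mul, Circle.norm_coe, one_mul, ← sub_mul]
    exact mul_le_mul (norm_one_add_circleExp_le hθ) (hM q) (norm_nonneg _)
      ((norm_nonneg _).trans (norm_one_add_circleExp_le hθ))
  have sum_le := norm_sum_le_of_norm_add_le
    (z := fun w => Circle.exp (pathGain T e w * θ) *
      condChar (pathEnd T e w).1 (pathEnd T e w).2 θ)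
    (fun w => by rw [norm_mul, Circle.norm_coe, one_mul]; exact hM w) hpq pair_le
  rw [condChar_eq_sum_path 4, norm_div]
  rw [Fintype.card_pi_const, Fintype.card_fin] at sum_le
  norm_num at sum_le ⊢
  linarith

theorem countZeroOne_le_div_two_pow_add (t n : ℕ) :
    countZeroOne t ≤ countZeroOne (t / 2 ^ n) + n := by
  induction n generalizing t with
  | zero => simp
  | succ n ih =>
    have hhalf := countZeroOne_two_mul_add (t / 2) ⟨t % 2, t.mod_lt two_pos⟩
    rw [Nat.div_add_mod] at hhalf
    have hdigit : t % 2 * (1 - t / 2 % 2) ≤ 1 * 1 := by gcongr <;> omega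
    rw [pow_succ', ← Nat.div_div_eq_div_mul]
    linarith [ih (t / 2)]

theorem countZeroOne_div_two {t : ℕ} (ht : t % 4 ≠ 1) :
    countZeroOne (t / 2) = countZeroOne t := by
  have hhalf := countZeroOne_two_mul_add (t / 2) ⟨t % 2, t.mod_lt two_pos⟩
  rw [Nat.div_add_mod] at hhalf
  rcases Nat.mod_two_eq_zero_or_one t with h | h
  · simpa [h] using hhalf.symm
  · simpa [h, show t / 2 % 2 = 1 by omega] using hhalf.symm

theorem norm_condChar_le {θ : ℝ} (hθ : |θ| ≤ π) {t T : ℕ} (hT : T ∈ Set.Icc t (t + 1))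
    (e : Fin 2) : ‖condChar T e θ‖ ≤ Real.exp (-(θ ^ 2 / 640 * countZeroOne t)) := by
  induction t using Nat.strong_induction_on generalizing T e with
  | _ t ih =>
    obtain rfl | ht := Nat.eq_zero_or_pos t
    · simpa [countZeroOne] using norm_condChar_le_one T e θ
    by_cases h : t % 4 = 1
    -- Reading four digits gains a factor `1 - θ ^ 2 / 160` and uses up at most four blocks of ones.
    · have hT_mod : T % 4 = 1 ∨ T % 4 = 2 := by
        rw [Set.mem_Icc] at hT
        omega
      have hcount : (countZeroOne t : ℝ) ≤ countZeroOne (t / 2 ^ 4) + 4 :=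
        mod_cast countZeroOne_le_div_two_pow_add t 4
      calc ‖condChar T e θ‖
          ≤ (1 - θ ^ 2 / 160) * Real.exp (-(θ ^ 2 / 640 * countZeroOne (t / 2 ^ 4))) :=
            norm_condChar_le_of_pathEnd hT_mod e hθ fun w =>
              ih _ (by omega) (pathEnd_fst_mem_Icc hT e w) _
        _ ≤ Real.exp (-(θ ^ 2 / 160)) * Real.exp (-(θ ^ 2 / 640 * countZeroOne (t / 2 ^ 4))) := by
            gcongr
            exact Real.one_sub_le_exp_neg _
        _ ≤ Real.exp (-(θ ^ 2 / 640 * countZeroOne t)) := by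
            rw [← Real.exp_add, Real.exp_le_exp]
            nlinarith [sq_nonneg θ]
    · have hmem : (T + e) / 2 ∈ Set.Icc (t / 2) (t / 2 + 1) := by
        rw [Set.mem_Icc] at hT ⊢
        omega
      have hμ (μ : Fin 2) : ‖Circle.exp (digitGain T e μ * θ) * condChar ((T + e) / 2) μ θ‖ ≤
          Real.exp (-(θ ^ 2 / 640 * countZeroOne t)) := by
        rw [norm_mul, Circle.norm_coe, one_mul, ← countZeroOne_div_two h]
        exact ih _ (by omega) hmem μ
      rw [condChar_recurrence, norm_div, Complex.norm_ofNat, div_le_iff₀ two_pos]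
      refine (norm_sum_le_of_le _ fun μ _ => hμ μ).trans_eq ?_
      rw [Fin.sum_const, nsmul_eq_mul, mul_comm, Nat.cast_ofNat]

/-- The characteristic function of the masses `diffDensity t`. -/
noncomputable def diffChar (t : ℕ) : ℝ → ℂ :=
  charSeries (diffDensity t)

theorem diffChar_eq (t : ℕ) (θ : ℝ) :
    diffChar t θ = (condChar t 0 θ + condChar t 1 θ) / 2 := by
  have h := charSeries_average (summable_condDensity t) 0 2 θ
  simp only [Pi.zero_apply, sub_zero, Int.cast_zero, zero_mul, Circle.exp_zero, Circle.coe_one,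
    one_mul, Complex.ofReal_ofNat] at h
  exact h.trans (by rw [Fin.sum_univ_two, condChar, condChar])

theorem norm_diffChar_le {θ : ℝ} (hθ : |θ| ≤ π) (t : ℕ) :
    ‖diffChar t θ‖ ≤ Real.exp (-(θ ^ 2 / 640 * countZeroOne t)) := by
  have hle (e : Fin 2) := norm_condChar_le hθ (Set.left_mem_Icc.2 t.le_succ) e
  rw [diffChar_eq, norm_div, Complex.norm_ofNat]
  linarith [norm_add_le (condChar t 0 θ) (condChar t 1 θ), hle 0, hle 1]

/-! ### Bounds for the variances -/

theorem countZeroOne_two_mul (n : ℕ) : countZeroOne (2 * n) = countZeroOne n := by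
  simpa using countZeroOne_two_mul_add n 0

theorem countZeroOne_two_mul_add_one (n : ℕ) :
    countZeroOne (2 * n + 1) = countZeroOne n + (1 - n % 2) := by
  simpa using countZeroOne_two_mul_add n 1

theorem varianceSeq_two_mul (t : ℕ) :
    varianceSeq (2 * t) = varianceSeq t + (t % 2 : ℕ) := by
  obtain ⟨s, rfl | rfl⟩ := t.even_or_odd'
  · rw [show 2 * (2 * s) = 4 * s by ring, varianceSeq_four_mul, Nat.mul_mod_right, Nat.cast_zero,
      add_zero]
  · rw [show 2 * (2 * s + 1) = 4 * s + 2 by ring, varianceSeq_four_mul_add_two, Nat.mul_add_mod,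
      Nat.cast_one]

theorem abs_varianceSeq_succ_sub_le (t : ℕ) : |varianceSeq (t + 1) - varianceSeq t| ≤ 3 / 2 := by
  induction t using Nat.evenOddRec with
  | h0 => norm_num [varianceSeq_zero, varianceSeq_one, abs_le]
  | h_even s ih =>
    rw [varianceSeq_two_mul_add_one, varianceSeq_two_mul]
    rw [abs_le] at ih ⊢
    rcases Nat.mod_two_eq_zero_or_one s with hs | hs <;> rw [hs] <;> push_cast <;>
      constructor <;> linarith
  | h_odd s ih =>
    rw [show 2 * s + 1 + 1 = 2 * (s + 1) by ring, varianceSeq_two_mul_add_one,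
      varianceSeq_two_mul]
    rw [abs_le] at ih ⊢
    rcases Nat.mod_two_eq_zero_or_one (s + 1) with hs | hs <;> rw [hs] <;> push_cast <;>
      constructor <;> linarith

theorem countZeroOne_le_varianceSeq_and_succ (t : ℕ) :
    3 / 4 * (countZeroOne t : ℝ) ≤ varianceSeq t ∧
      3 / 4 * ((countZeroOne t : ℝ) - (t % 2 : ℕ)) ≤ varianceSeq (t + 1) := by
  induction t using Nat.evenOddRec with
  | h0 => norm_num [countZeroOne, varianceSeq_zero, varianceSeq_one]
  | h_even s ih =>
    obtain ⟨hs, hs_succ⟩ := ih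
    rw [countZeroOne_two_mul, varianceSeq_two_mul_add_one, varianceSeq_two_mul, Nat.mul_mod_right]
    rcases Nat.mod_two_eq_zero_or_one s with h | h <;> rw [h] at hs_succ ⊢ <;>
      push_cast at hs_succ ⊢ <;> constructor <;> linarith
  | h_odd s ih =>
    obtain ⟨hs, hs_succ⟩ := ih
    rw [show 2 * s + 1 + 1 = 2 * (s + 1) by ring, countZeroOne_two_mul_add_one,
      varianceSeq_two_mul_add_one, varianceSeq_two_mul, Nat.mul_add_mod, Nat.add_mod s 1]
    rcases Nat.mod_two_eq_zero_or_one s with h | h <;> rw [h] at hs_succ ⊢ <;>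
      norm_num at hs_succ ⊢ <;> constructor <;> linarith

theorem countZeroOne_le_varianceSeq (t : ℕ) : 3 / 4 * (countZeroOne t : ℝ) ≤ varianceSeq t :=
  (countZeroOne_le_varianceSeq_and_succ t).1

theorem varianceSeq_nonneg (t : ℕ) : 0 ≤ varianceSeq t :=
  le_trans (by positivity) (countZeroOne_le_varianceSeq t)

theorem varianceSeq_le_and_succ_le (t : ℕ) :
    varianceSeq t ≤ 5 * countZeroOne t + 5 / 2 - (t % 2 : ℕ) ∧
      varianceSeq (t + 1) ≤ 5 * countZeroOne t + 4 - 4 * (t % 2 : ℕ) := by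
  induction t using Nat.evenOddRec with
  | h0 => norm_num [countZeroOne, varianceSeq_zero, varianceSeq_one]
  | h_even s ih =>
    obtain ⟨hs, hs_succ⟩ := ih
    rw [countZeroOne_two_mul, varianceSeq_two_mul_add_one, varianceSeq_two_mul, Nat.mul_mod_right]
    rcases Nat.mod_two_eq_zero_or_one s with h | h <;> rw [h] at hs hs_succ ⊢ <;>
      push_cast at hs hs_succ ⊢ <;> constructor <;> linarith
  | h_odd s ih =>
    obtain ⟨hs, hs_succ⟩ := ih
    rw [show 2 * s + 1 + 1 = 2 * (s + 1) by ring, countZeroOne_two_mul_add_one,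
      varianceSeq_two_mul_add_one, varianceSeq_two_mul, Nat.mul_add_mod, Nat.add_mod s 1]
    rcases Nat.mod_two_eq_zero_or_one s with h | h <;> rw [h] at hs hs_succ ⊢ <;>
      norm_num at hs hs_succ ⊢ <;> constructor <;> linarith

theorem varianceSeq_le (t : ℕ) : varianceSeq t ≤ 5 * countZeroOne t + 5 / 2 :=
  (varianceSeq_le_and_succ_le t).1.trans (sub_le_self _ (Nat.cast_nonneg _))

/-! ### Averages of Gaussians -/

theorem abs_cos_sub_exp_le (x : ℝ) :
    |Real.cos x - Real.exp (-(x ^ 2 / 2))| ≤ |x| ^ 3 / 2 := by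
  have hsq : |x| ^ 2 = x ^ 2 := sq_abs x
  rcases le_total |x| 1 with hx | hx
  · have hcos := Real.cos_bound hx
    have hexp := Real.abs_exp_sub_one_sub_id_le (x := -(x ^ 2 / 2)) (by
      rw [abs_neg, abs_of_nonneg (by positivity)]
      nlinarith [abs_nonneg x])
    have hpow : |x| ^ 4 ≤ |x| ^ 3 := pow_le_pow_of_le_one (abs_nonneg x) hx (by norm_num)
    have hpow_four : (-(x ^ 2 / 2)) ^ 2 = |x| ^ 4 / 4 := by rw [← hsq]; ring
    rw [abs_le] at hcos hexp ⊢
    constructor <;> linarith [pow_nonneg (abs_nonneg x) 3]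
  · have hpow : |x| ^ 2 ≤ |x| ^ 3 := pow_le_pow_right₀ hx (by norm_num)
    have hexp : Real.exp (-(x ^ 2 / 2)) ≤ 1 := Real.exp_le_one_iff.2 (by linarith [sq_nonneg x])
    rw [abs_le]
    constructor <;>
      linarith [Real.one_sub_sq_div_two_le_cos (x := x), Real.cos_le_one x,
        Real.add_one_le_exp (-(x ^ 2 / 2))]

theorem abs_exp_neg_sub_exp_neg_le_one {a b : ℝ} (ha : 0 ≤ a) (hb : 0 ≤ b) :
    |Real.exp (-a) - Real.exp (-b)| ≤ 1 :=
  abs_sub_le_of_nonneg_of_le (Real.exp_nonneg _) (Real.exp_le_one_iff.2 (neg_nonpos.2 ha))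
    (Real.exp_nonneg _) (Real.exp_le_one_iff.2 (neg_nonpos.2 hb))

theorem abs_exp_neg_sub_exp_neg_le {a b : ℝ} (ha : 0 ≤ a) (hb : 0 ≤ b) :
    |Real.exp (-a) - Real.exp (-b)| ≤ |a - b| := by
  wlog hab : a ≤ b generalizing a b
  · rw [abs_sub_comm, abs_sub_comm a]
    exact this hb ha (le_of_not_ge hab)
  have hexp : Real.exp (-b) = Real.exp (-a) * Real.exp (-(b - a)) := by
    rw [← Real.exp_add]
    ring_nf
  have hle : Real.exp (-b) ≤ Real.exp (-a) := Real.exp_le_exp.2 (neg_le_neg hab)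
  rw [abs_of_nonneg (sub_nonneg.2 hle), abs_sub_comm, abs_of_nonneg (sub_nonneg.2 hab), hexp]
  nlinarith [Real.one_sub_le_exp_neg (b - a), Real.exp_le_one_iff.2 (neg_nonpos.2 ha),
    Real.exp_pos (-a)]

theorem abs_exp_add_exp_div_two_sub_le {a b θ : ℝ} (ha : 0 ≤ a) (hb : 0 ≤ b)
    (hab : |a - b| ≤ θ ^ 2) :
    |(Real.exp (-a) + Real.exp (-b)) / 2 - Real.exp (-((a + b) / 2))| ≤ |θ| ^ 3 / 2 := by
  set d := |Real.exp (-(a / 2)) - Real.exp (-(b / 2))| with hd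
  have hd_one : d ≤ 1 := abs_exp_neg_sub_exp_neg_le_one (by positivity) (by positivity)
  have hd_sq : d ≤ |θ| ^ 2 := by
    refine (abs_exp_neg_sub_exp_neg_le (by positivity) (by positivity)).trans ?_
    rw [← sub_div, abs_div, abs_two, sq_abs]
    linarith [sq_nonneg θ]
  have square : (Real.exp (-a) + Real.exp (-b)) / 2 - Real.exp (-((a + b) / 2)) = d ^ 2 / 2 := by
    rw [hd, sq_abs, sub_sq, ← Real.exp_nat_mul, ← Real.exp_nat_mul, mul_assoc, ← Real.exp_add]
    push_cast
    ring_nf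
  have hd_cube : d ^ 2 ≤ |θ| ^ 3 := by
    rcases le_total |θ| 1 with hθ | hθ
    · calc d ^ 2 ≤ (|θ| ^ 2) ^ 2 := by gcongr
        _ = |θ| ^ 4 := by ring
        _ ≤ |θ| ^ 3 := pow_le_pow_of_le_one (abs_nonneg θ) hθ (by norm_num)
    · exact (pow_le_one₀ (abs_nonneg _) hd_one).trans (one_le_pow₀ hθ)
  rw [square, abs_of_nonneg (by positivity)]
  gcongr

theorem circleExp_mul_add_circleExp_neg_mul (x : ℝ) (z w : ℂ) :
    Circle.exp x * z + Circle.exp (-x) * w =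
      Real.cos x * (z + w) + Real.sin x * (z - w) * Complex.I := by
  simp only [Circle.coe_exp, Complex.ofReal_neg, Complex.exp_mul_I, Complex.cos_neg,
    Complex.sin_neg, Complex.ofReal_cos, Complex.ofReal_sin]
  ring

theorem abs_cos_mul_sub_exp_mul_exp_le {a b x θ : ℝ} (ha : 0 ≤ a) (hb : 0 ≤ b)
    (hab : |a - b| ≤ θ ^ 2) (hx : |x| ≤ 3 / 2 * |θ|) :
    |Real.cos x * ((Real.exp (-a) + Real.exp (-b)) / 2) -
      Real.exp (-((a + b) / 2)) * Real.exp (-(x ^ 2 / 2))| ≤ 35 / 16 * |θ| ^ 3 := by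
  have split : Real.cos x * ((Real.exp (-a) + Real.exp (-b)) / 2) -
      Real.exp (-((a + b) / 2)) * Real.exp (-(x ^ 2 / 2)) =
      Real.cos x * ((Real.exp (-a) + Real.exp (-b)) / 2 - Real.exp (-((a + b) / 2))) +
        Real.exp (-((a + b) / 2)) * (Real.cos x - Real.exp (-(x ^ 2 / 2))) := by ring
  have hexp_le : Real.exp (-((a + b) / 2)) ≤ 1 := Real.exp_le_one_iff.2 (by linarith)
  calc _ ≤ |(Real.exp (-a) + Real.exp (-b)) / 2 - Real.exp (-((a + b) / 2))| +
        |Real.cos x - Real.exp (-(x ^ 2 / 2))| := by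
        rw [split]
        refine (abs_add_le _ _).trans (add_le_add ?_ ?_)
        · rw [abs_mul]
          exact mul_le_of_le_one_left (abs_nonneg _) (Real.abs_cos_le_one x)
        · rw [abs_mul, Real.abs_exp]
          exact mul_le_of_le_one_left (abs_nonneg _) hexp_le
    _ ≤ |θ| ^ 3 / 2 + (3 / 2 * |θ|) ^ 3 / 2 := by
        refine add_le_add (abs_exp_add_exp_div_two_sub_le ha hb hab)
          ((abs_cos_sub_exp_le x).trans ?_)
        gcongr
    _ = 35 / 16 * |θ| ^ 3 := by ring

theorem norm_circleExp_mul_exp_average_sub_le {a b x θ : ℝ} (ha : 0 ≤ a) (hb : 0 ≤ b)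
    (hab : |a - b| ≤ θ ^ 2) (hx : |x| ≤ 3 / 2 * |θ|) :
    ‖(Circle.exp x * Real.exp (-a) + Circle.exp (-x) * Real.exp (-b) : ℂ) / 2 -
      Real.exp (-((a + b) / 2 + x ^ 2 / 2))‖ ≤ 3 * |θ| ^ 3 := by
  have imaginary_part : |Real.sin x * ((Real.exp (-a) - Real.exp (-b)) / 2)| ≤
      3 / 4 * |θ| ^ 3 := by
    rw [abs_mul, abs_div, abs_two]
    calc _ ≤ (3 / 2 * |θ|) * (|θ| ^ 2 / 2) := by
          gcongr
          · exact Real.abs_sin_le_abs.trans hx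
          · rw [sq_abs]
            exact (abs_exp_neg_sub_exp_neg_le ha hb).trans hab
      _ = 3 / 4 * |θ| ^ 3 := by ring
  have re_add_im : (Circle.exp x * Real.exp (-a) + Circle.exp (-x) * Real.exp (-b) : ℂ) / 2 -
      Real.exp (-((a + b) / 2 + x ^ 2 / 2)) =
      ((Real.cos x * ((Real.exp (-a) + Real.exp (-b)) / 2) -
        Real.exp (-((a + b) / 2)) * Real.exp (-(x ^ 2 / 2)) : ℝ) : ℂ) +
      ((Real.sin x * ((Real.exp (-a) - Real.exp (-b)) / 2) : ℝ) : ℂ) * Complex.I := by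
    rw [circleExp_mul_add_circleExp_neg_mul, neg_add, Real.exp_add]
    push_cast
    ring
  rw [re_add_im]
  refine (norm_add_le _ _).trans ?_
  rw [norm_mul, Complex.norm_I, mul_one, Complex.norm_real, Complex.norm_real]
  refine (add_le_add (abs_cos_mul_sub_exp_mul_exp_le ha hb hab hx) imaginary_part).trans ?_
  linarith [pow_nonneg (abs_nonneg θ) 3]

theorem norm_gaussian_average_sub_le {α β s : ℝ} (hα : 0 ≤ α) (hβ : 0 ≤ β) (hαβ : |α - β| ≤ 2)
    (hs : |s| ≤ 3 / 2) (θ : ℝ) :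
    ‖(Circle.exp (s * θ) * Real.exp (-(α * θ ^ 2 / 2)) +
        Circle.exp (-(s * θ)) * Real.exp (-(β * θ ^ 2 / 2)) : ℂ) / 2 -
      Real.exp (-(((α + β) / 2 + s ^ 2) * θ ^ 2 / 2))‖ ≤ 3 * |θ| ^ 3 := by
  have hdiff : |α * θ ^ 2 / 2 - β * θ ^ 2 / 2| ≤ θ ^ 2 := by
    rw [← sub_div, ← sub_mul, abs_div, abs_mul, abs_two, abs_of_nonneg (sq_nonneg θ)]
    nlinarith [sq_nonneg θ]
  have hshift : |s * θ| ≤ 3 / 2 * |θ| := by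
    rw [abs_mul]
    gcongr
  have exponent : ((α + β) / 2 + s ^ 2) * θ ^ 2 / 2 =
      (α * θ ^ 2 / 2 + β * θ ^ 2 / 2) / 2 + (s * θ) ^ 2 / 2 := by ring
  rw [exponent]
  exact norm_circleExp_mul_exp_average_sub_le (by positivity) (by positivity) hdiff hshift

theorem norm_circle_average_sub_le (u u' : Circle) (z₀ z₁ g₀ g₁ g : ℂ) :
    ‖(u * z₀ + u' * z₁) / 2 - g‖ ≤
      (‖z₀ - g₀‖ + ‖z₁ - g₁‖) / 2 + ‖(u * g₀ + u' * g₁) / 2 - g‖ := by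
  have split : (u * z₀ + u' * z₁) / 2 - g =
      (u * (z₀ - g₀) + u' * (z₁ - g₁)) / 2 + ((u * g₀ + u' * g₁) / 2 - g) := by ring
  have hle := norm_add_le (u * (z₀ - g₀)) (u' * (z₁ - g₁))
  rw [norm_mul, norm_mul, Circle.norm_coe, Circle.norm_coe, one_mul, one_mul] at hle
  rw [split]
  refine (norm_add_le _ _).trans (add_le_add_left ?_ _)
  rw [norm_div, Complex.norm_ofNat]
  gcongr

/-! ### Gaussian approximation of the characteristic functions -/

/-- The mean of the masses `condDensity T e`, in closed form. -/
noncomputable def condMean (T : ℕ) (e : Fin 2) : ℝ :=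
  if T % 2 = 0 then 0 else 1 / 2 - (e : ℕ)

/-- The variance of the masses `condDensity T e`, in closed form. -/
noncomputable def condVar (T : ℕ) (e : Fin 2) : ℝ :=
  varianceSeq ((T + e) / 2) +
    if T % 2 = 0 then if (T + e) / 2 % 2 = 0 then (0 : ℝ) else 2 * (e : ℕ)
    else if (T + e) / 2 % 2 = 0 then (1 / 4 : ℝ) else 3 / 4

/-- The gain of the last digit `e` after the digit `0`, with the means of the two sides of
`blockDiff_two_mul_add` subtracted. -/
noncomputable def centeredGain (T : ℕ) (e : Fin 2) : ℝ :=
  digitGain T e 0 + condMean ((T + e) / 2) 0 - condMean T e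

theorem centeredGain_eq (T : ℕ) (e : Fin 2) : centeredGain T e =
    if T % 2 = 0 then if (T + e) / 2 % 2 = 0 then (0 : ℝ) else 1 / 2 + (e : ℕ)
    else if (T + e) / 2 % 2 = 0 then ((e : ℕ) - 1 / 2 : ℝ) else 1 := by
  have hadd : (T + e) % 2 = (T % 2 + e) % 2 := by omega
  rw [centeredGain, digitGain, condMean, condMean, Fin.val_zero, zero_add, hadd]
  rcases Nat.mod_two_eq_zero_or_one T with hT | hT <;>
  rcases Nat.mod_two_eq_zero_or_one ((T + e) / 2) with h | h <;>
  rw [hT, h] <;> fin_cases e <;> norm_num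

theorem digitGain_one_add_condMean_sub (T : ℕ) (e : Fin 2) :
    digitGain T e 1 + condMean ((T + e) / 2) 1 - condMean T e = -centeredGain T e := by
  have hadd : (T + e) % 2 = (T % 2 + e) % 2 := by omega
  have hcarry : (1 + (T + e) / 2) % 2 = 1 - (T + e) / 2 % 2 := by omega
  rw [centeredGain_eq, digitGain, condMean, condMean, Fin.val_one, hcarry, hadd]
  rcases Nat.mod_two_eq_zero_or_one T with hT | hT <;>
  rcases Nat.mod_two_eq_zero_or_one ((T + e) / 2) with h | h <;>
  rw [hT, h] <;> fin_cases e <;> norm_num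

theorem abs_centeredGain_le (T : ℕ) (e : Fin 2) : |centeredGain T e| ≤ 3 / 2 := by
  rw [centeredGain_eq]
  fin_cases e <;> split_ifs <;> norm_num [abs_le]

theorem condVar_two_mul (s : ℕ) (e : Fin 2) :
    condVar (2 * s) e = varianceSeq s + if s % 2 = 0 then (0 : ℝ) else 2 * (e : ℕ) := by
  have hhalf : (2 * s + e) / 2 = s := by omega
  simp only [condVar, hhalf, Nat.mul_mod_right, if_true]

theorem condVar_two_mul_add_one (s : ℕ) (e : Fin 2) : condVar (2 * s + 1) e =
    varianceSeq (s + e) + if (s + e) % 2 = 0 then (1 / 4 : ℝ) else 3 / 4 := by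
  have hhalf : (2 * s + 1 + e) / 2 = s + e := by omega
  have hodd : ¬(2 * s + 1) % 2 = 0 := by omega
  simp only [condVar, hhalf, if_neg hodd]

theorem condVar_average (T : ℕ) : (condVar T 0 + condVar T 1) / 2 =
    varianceSeq T - if T % 2 = 0 then (0 : ℝ) else 1 / 4 := by
  obtain ⟨s, rfl | rfl⟩ := T.even_or_odd'
  · rw [condVar_two_mul, condVar_two_mul, varianceSeq_two_mul]
    rcases Nat.mod_two_eq_zero_or_one s with hs | hs <;> norm_num [hs]
    ring
  · rw [condVar_two_mul_add_one, condVar_two_mul_add_one, varianceSeq_two_mul_add_one,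
      Fin.val_zero, Fin.val_one, add_zero]
    split_ifs <;> first | omega | ring

theorem condVar_eq (T : ℕ) (e : Fin 2) : condVar T e =
    (condVar ((T + e) / 2) 0 + condVar ((T + e) / 2) 1) / 2 + centeredGain T e ^ 2 := by
  rw [condVar_average, condVar, centeredGain_eq]
  fin_cases e <;> split_ifs <;> norm_num <;> ring

theorem condVar_nonneg (T : ℕ) (e : Fin 2) : 0 ≤ condVar T e := by
  refine add_nonneg (varianceSeq_nonneg _) ?_
  split_ifs <;> positivity

theorem abs_condVar_sub_le (T : ℕ) : |condVar T 0 - condVar T 1| ≤ 2 := by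
  obtain ⟨s, rfl | rfl⟩ := T.even_or_odd'
  · rw [condVar_two_mul, condVar_two_mul]
    split_ifs <;> norm_num
  · rw [condVar_two_mul_add_one, condVar_two_mul_add_one, Fin.val_zero, Fin.val_one, add_zero]
    have := abs_le.1 (abs_varianceSeq_succ_sub_le s)
    split_ifs <;> first | omega | exact abs_le.2 ⟨by linarith, by linarith⟩

theorem condVar_eq_of_mod_four {T : ℕ} (hT : T % 4 = 0) : condVar T 0 = condVar T 1 := by
  obtain ⟨s, rfl⟩ : ∃ s, T = 2 * s := ⟨T / 2, by omega⟩
  have hs : s % 2 = 0 := by omega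
  rw [condVar_two_mul, condVar_two_mul, if_pos hs, if_pos hs]

/-- The characteristic function of the masses `condDensity T e`, recentered at their mean. -/
noncomputable def centeredChar (T : ℕ) (e : Fin 2) (θ : ℝ) : ℂ :=
  Circle.exp (-(condMean T e * θ)) * condChar T e θ

theorem centeredChar_recurrence (T : ℕ) (e : Fin 2) (θ : ℝ) : centeredChar T e θ =
    (Circle.exp (centeredGain T e * θ) * centeredChar ((T + e) / 2) 0 θ +
      Circle.exp (-(centeredGain T e * θ)) * centeredChar ((T + e) / 2) 1 θ) / 2 := by
  have gain_zero : Circle.exp (-(condMean T e * θ)) * Circle.exp (digitGain T e 0 * θ) =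
      Circle.exp (centeredGain T e * θ) * Circle.exp (-(condMean ((T + e) / 2) 0 * θ)) := by
    rw [← Circle.exp_add, ← Circle.exp_add, centeredGain]
    ring_nf
  have gain_one : Circle.exp (-(condMean T e * θ)) * Circle.exp (digitGain T e 1 * θ) =
      Circle.exp (-(centeredGain T e * θ)) * Circle.exp (-(condMean ((T + e) / 2) 1 * θ)) := by
    rw [← Circle.exp_add, ← Circle.exp_add, ← neg_mul (centeredGain T e),
      ← digitGain_one_add_condMean_sub]
    ring_nf
  simp only [centeredChar, condChar_recurrence T e θ, Fin.sum_univ_two, ← mul_assoc,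
    ← Circle.coe_mul, ← gain_zero, ← gain_one]
  push_cast
  ring

/-- The error of the Gaussian approximation to `centeredChar T e`. -/
noncomputable def gaussianError (T : ℕ) (e : Fin 2) (θ : ℝ) : ℝ :=
  ‖centeredChar T e θ - Real.exp (-(condVar T e * θ ^ 2 / 2))‖

theorem gaussianError_le_add (T : ℕ) (e : Fin 2) (θ : ℝ) : gaussianError T e θ ≤
    (gaussianError ((T + e) / 2) 0 θ + gaussianError ((T + e) / 2) 1 θ) / 2 + 3 * |θ| ^ 3 := by
  rw [gaussianError, centeredChar_recurrence]
  refine (norm_circle_average_sub_le _ _ _ _ _ _ _).trans (add_le_add_right ?_ _)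
  rw [condVar_eq T e]
  exact norm_gaussian_average_sub_le (condVar_nonneg _ _) (condVar_nonneg _ _)
    (abs_condVar_sub_le _) (abs_centeredGain_le _ _) θ

theorem gaussianError_le_of_centeredGain_eq_zero {T : ℕ} {e : Fin 2}
    (hgain : centeredGain T e = 0) (hvar : condVar ((T + e) / 2) 0 = condVar ((T + e) / 2) 1)
    (θ : ℝ) : gaussianError T e θ ≤
      (gaussianError ((T + e) / 2) 0 θ + gaussianError ((T + e) / 2) 1 θ) / 2 := by
  rw [gaussianError, centeredChar_recurrence]
  refine (norm_circle_average_sub_le _ _ _ _ _ _ _).trans_eq (add_eq_left.2 ?_)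
  rw [condVar_eq T e, hgain, hvar]
  simp

theorem gaussianError_zero (e : Fin 2) (θ : ℝ) : gaussianError 0 e θ = 0 := by
  have hvar : condVar 0 e = 0 := by
    fin_cases e <;> simp [condVar, varianceSeq_zero]
  simp [gaussianError, hvar, centeredChar, condMean, condChar_zero]

theorem one_fourth_le_centeredGain_sq {T : ℕ} {e : Fin 2}
    (h : ¬(T % 2 = 0 ∧ (T + e) / 2 % 2 = 0)) : 1 / 4 ≤ centeredGain T e ^ 2 := by
  rw [centeredGain_eq]
  fin_cases e <;> split_ifs <;> first | tauto | norm_num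

-- Each error `3 * |θ| ^ 3` is paid for by the growth of the variance. A step that does not increase
-- the variance costs nothing unless it leads to a `T` with `T % 4 = 2`, and then it is paid for by
-- the `3` held in reserve at such `T`.
theorem gaussianError_le_of_carry {T : ℕ} {e : Fin 2} {θ : ℝ} (ih : ∀ μ,
    gaussianError ((T + e) / 2) μ θ ≤ (24 * condVar ((T + e) / 2) μ -
      if (T + e) / 2 % 4 = 2 then (3 : ℝ) else 0) * |θ| ^ 3) :
    gaussianError T e θ ≤ (24 * condVar T e - if T % 4 = 2 then (3 : ℝ) else 0) * |θ| ^ 3 := by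
  have hcube : 0 ≤ |θ| ^ 3 := by positivity
  have ih_zero := ih 0
  have ih_one := ih 1
  have hvar := condVar_eq T e
  have hstep := gaussianError_le_add T e θ
  by_cases hgain : T % 2 = 0 ∧ (T + e) / 2 % 2 = 0
  · have hgain_zero : centeredGain T e = 0 := by
      rw [centeredGain_eq, if_pos hgain.1, if_pos hgain.2]
    rw [hgain_zero] at hvar
    rw [if_neg (by omega), hvar]
    by_cases hmod : (T + e) / 2 % 4 = 2
    · rw [if_pos hmod] at ih_zero ih_one
      linarith
    · have hvar_eq : condVar ((T + e) / 2) 0 = condVar ((T + e) / 2) 1 :=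
        condVar_eq_of_mod_four (by omega)
      rw [if_neg hmod] at ih_zero ih_one
      linarith [gaussianError_le_of_centeredGain_eq_zero hgain_zero hvar_eq θ]
  · have hgain_sq := one_fourth_le_centeredGain_sq hgain
    have hcredit : 0 ≤ if (T + e) / 2 % 4 = 2 then (3 : ℝ) else 0 := by positivity
    have hcredit_le : (if T % 4 = 2 then (3 : ℝ) else 0) ≤ 3 := by split_ifs <;> norm_num
    nlinarith

theorem gaussianError_le (T : ℕ) (e : Fin 2) (θ : ℝ) : gaussianError T e θ ≤
    (24 * condVar T e - if T % 4 = 2 then (3 : ℝ) else 0) * |θ| ^ 3 := by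
  induction T using Nat.strong_induction_on generalizing e with
  | _ T ih =>
    obtain rfl | hT := Nat.eq_zero_or_pos T
    · have := condVar_nonneg 0 e
      rw [gaussianError_zero, if_neg (by norm_num), sub_zero]
      positivity
    by_cases hlt : (T + e) / 2 < T
    · exact gaussianError_le_of_carry fun μ => ih _ hlt μ
    obtain ⟨rfl, rfl⟩ : T = 1 ∧ e = 1 := by omega
    have hzero := gaussianError_le_of_carry (T := 1) (e := 0) fun μ => ih 0 one_pos μ
    have hself := gaussianError_le_add 1 1 θ
    have hvar_zero : condVar 1 0 = 1 / 4 := by norm_num [condVar, varianceSeq_zero]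
    have hvar_one : condVar 1 1 = 9 / 4 := by norm_num [condVar, varianceSeq_one]
    have hcube : 0 ≤ |θ| ^ 3 := by positivity
    norm_num [hvar_zero, hvar_one] at hzero hself ⊢
    linarith

theorem norm_diffChar_sub_le (t : ℕ) (θ : ℝ) :
    ‖diffChar t θ - Real.exp (-(varianceSeq t * θ ^ 2 / 2))‖ ≤
      (24 * varianceSeq t + 3) * |θ| ^ 3 := by
  have hmean_one : condMean t 1 = -condMean t 0 := by
    norm_num [condMean]
    split_ifs <;> norm_num
  have hmean_le : |condMean t 0| ≤ 3 / 2 := by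
    rw [condMean]
    split_ifs <;> norm_num [abs_le]
  have hvar : varianceSeq t = (condVar t 0 + condVar t 1) / 2 + condMean t 0 ^ 2 := by
    rw [condVar_average, condMean]
    split_ifs <;> norm_num
  have condChar_eq (e : Fin 2) :
      condChar t e θ = Circle.exp (condMean t e * θ) * centeredChar t e θ := by
    rw [centeredChar, ← mul_assoc, ← Circle.coe_mul, ← Circle.exp_add, add_neg_cancel,
      Circle.exp_zero, Circle.coe_one, one_mul]
  have herror (e : Fin 2) : gaussianError t e θ ≤ 24 * condVar t e * |θ| ^ 3 := by
    refine (gaussianError_le t e θ).trans (mul_le_mul_of_nonneg_right ?_ (by positivity))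
    exact sub_le_self _ (by positivity)
  have hcube : 0 ≤ condMean t 0 ^ 2 * |θ| ^ 3 := by positivity
  rw [diffChar_eq, condChar_eq, condChar_eq, hmean_one, neg_mul]
  have haverage := norm_gaussian_average_sub_le (condVar_nonneg t 0) (condVar_nonneg t 1)
    (abs_condVar_sub_le t) hmean_le θ
  rw [← hvar] at haverage
  refine (norm_circle_average_sub_le _ _ _ _ (Real.exp (-(condVar t 0 * θ ^ 2 / 2)))
    (Real.exp (-(condVar t 1 * θ ^ 2 / 2))) _).trans ((add_le_add_right haverage _).trans ?_)
  change (gaussianError t 0 θ + gaussianError t 1 θ) / 2 + 3 * |θ| ^ 3 ≤ _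
  rw [hvar]
  linarith [herror 0, herror 1]

/-! ### The local limit theorem -/

theorem norm_diffChar_sub_le_of_log_le {t : ℕ} {θ : ℝ} (hN : 0 < countZeroOne t) (hθ : |θ| ≤ π)
    (hlog : 640 * Real.log (countZeroOne t) / countZeroOne t ≤ θ ^ 2) :
    ‖diffChar t θ - Real.exp (-(varianceSeq t * θ ^ 2 / 2))‖ ≤ 2 / countZeroOne t := by
  have hNpos : (0 : ℝ) < countZeroOne t := Nat.cast_pos.2 hN
  have hlog_nonneg : 0 ≤ Real.log (countZeroOne t) := Real.log_natCast_nonneg _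
  have hvar := countZeroOne_le_varianceSeq t
  have exp_neg_log : Real.exp (-Real.log (countZeroOne t)) = 1 / countZeroOne t := by
    rw [Real.exp_neg, Real.exp_log hNpos, one_div]
  rw [div_le_iff₀ hNpos] at hlog
  have hchar : ‖diffChar t θ‖ ≤ 1 / countZeroOne t := by
    refine (norm_diffChar_le hθ t).trans (exp_neg_log ▸ Real.exp_le_exp.2 ?_)
    linarith
  have hgauss : ‖(Real.exp (-(varianceSeq t * θ ^ 2 / 2)) : ℂ)‖ ≤ 1 / countZeroOne t := by
    rw [Complex.norm_real, Real.norm_eq_abs, Real.abs_exp]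
    refine exp_neg_log ▸ Real.exp_le_exp.2 ?_
    nlinarith [sq_nonneg θ]
  calc _ ≤ 1 / (countZeroOne t : ℝ) + 1 / countZeroOne t :=
        (norm_sub_le _ _).trans (add_le_add hchar hgauss)
    _ = _ := by ring

theorem exp_neg_mul_pi_sq_mul_sqrt_le {N v : ℝ} (hN : 3 ≤ N) (hv : 3 / 4 * N ≤ v) :
    Real.exp (-(v * π ^ 2 / 4)) * √(π / (v / 4)) ≤ 4 / N := by
  have hπ := Real.pi_gt_three
  have hexp : Real.exp (-(v * π ^ 2 / 4)) ≤ 4 / 3 / N := by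
    have hle : v * 4 ≤ v * π ^ 2 := by
      gcongr <;> nlinarith
    rw [Real.exp_neg, inv_eq_one_div, div_le_div_iff₀ (Real.exp_pos _) (by linarith)]
    linarith [Real.add_one_le_exp (v * π ^ 2 / 4)]
  have hsqrt : √(π / (v / 4)) ≤ 3 := by
    refine Real.sqrt_le_iff.2 ⟨by norm_num, ?_⟩
    rw [div_le_iff₀ (by linarith)]
    linarith [Real.pi_lt_four]
  calc _ ≤ 4 / 3 / N * 3 := by gcongr
    _ = _ := by ring

theorem one_le_log_of_three_le {x : ℝ} (hx : 3 ≤ x) : 1 ≤ Real.log x := by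
  rw [Real.le_log_iff_exp_le (by linarith)]
  linarith [Real.exp_one_lt_d9]

theorem cutoff_error_le {N v L r : ℝ} (hN : 3 ≤ N) (hv : 3 / 4 * N ≤ v) (hL : 1 ≤ L)
    (hr : r ^ 2 = 640 * L / N) :
    (2 * r * (150 * N * r ^ 3) + 2 * π * (2 / N) + Real.exp (-(v * π ^ 2 / 4)) * √(π / (v / 4))) /
      (2 * π) ≤ 10 ^ 9 * L ^ 2 / N := by
  have : 0 < N := by linarith
  have hcentral : 2 * r * (150 * N * r ^ 3) = 300 * 640 ^ 2 * (L ^ 2 / N) := by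
    rw [show 2 * r * (150 * N * r ^ 3) = 300 * N * (r ^ 2) ^ 2 by ring, hr]
    field_simp
  have hinv : 1 / N ≤ L ^ 2 / N := by
    gcongr
    exact one_le_pow₀ hL
  have hπ_inv : 2 * π * (2 / N) ≤ 16 * (1 / N) := by
    rw [show 2 * π * (2 / N) = 4 * π * (1 / N) by ring]
    gcongr
    linarith [Real.pi_lt_four]
  have htail := exp_neg_mul_pi_sq_mul_sqrt_le hN hv
  rw [div_eq_mul_one_div 4 N] at htail
  have hsq : 0 ≤ L ^ 2 / N := by positivity
  rw [div_le_iff₀ Real.two_pi_pos, mul_div_assoc (10 ^ 9 : ℝ)]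
  nlinarith [Real.pi_gt_three]

theorem abs_diffDensity_sub_gaussian_le {t : ℕ} (hN : 3 ≤ countZeroOne t) (k : ℤ) :
    |diffDensity t k - (√(2 * π * varianceSeq t))⁻¹ *
        Real.exp (-((k : ℝ) ^ 2 / (2 * varianceSeq t)))| ≤
      10 ^ 9 * Real.log (countZeroOne t) ^ 2 / countZeroOne t := by
  have hN_real : (3 : ℝ) ≤ countZeroOne t := Nat.ofNat_le_cast.2 hN
  have hvar := countZeroOne_le_varianceSeq t
  have hlog := one_le_log_of_three_le hN_real
  have hcutoff : 0 ≤ 640 * Real.log (countZeroOne t) / countZeroOne t := by positivity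
  set r := √(640 * Real.log (countZeroOne t) / countZeroOne t)
  have inner (θ : ℝ) (hθ : |θ| ≤ r) :
      ‖diffChar t θ - Real.exp (-(varianceSeq t * θ ^ 2 / 2))‖ ≤
        150 * countZeroOne t * r ^ 3 := by
    refine (norm_diffChar_sub_le t θ).trans ?_
    gcongr
    linarith [varianceSeq_le t]
  have outer (θ : ℝ) (hθ : r < |θ|) (hθπ : |θ| ≤ π) :
      ‖diffChar t θ - Real.exp (-(varianceSeq t * θ ^ 2 / 2))‖ ≤ 2 / countZeroOne t := by
    refine norm_diffChar_sub_le_of_log_le (by omega) hθπ ?_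
    rw [← sq_abs]
    exact (Real.sqrt_le_left (abs_nonneg θ)).1 hθ.le
  exact (abs_sub_gaussian_le_of_norm_charSeries_sub_le (summable_diffDensity t) (by linarith)
    (Real.sqrt_nonneg _) (by positivity) inner outer k).trans
    (cutoff_error_le hN_real hvar hlog (Real.sq_sqrt hcutoff))

/-- The densities `c t k` of the sets `{n : d(t, n) = k}` exist, and they are uniformly close to a
Gaussian of mean `0` and variance `v_t`. -/
theorem mainTheorem1 :
    ∃ c : ℕ → ℤ → ℝ,
      (∀ (t : ℕ) (k : ℤ), HasAsymptoticDensity {n : ℕ | blockDiff t n = k} (c t k)) ∧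
      ∃ C N₀ : ℕ, ∀ t : ℕ, N₀ ≤ countZeroOne t → ∀ k : ℤ,
        |c t k - (Real.sqrt (2 * Real.pi * varianceSeq t))⁻¹ *
            Real.exp (-((k : ℝ) ^ 2 / (2 * varianceSeq t)))| ≤
          (C : ℝ) * (Real.log (countZeroOne t : ℝ)) ^ 2 / (countZeroOne t : ℝ) := by
  refine ⟨diffDensity, hasAsymptoticDensity_diffDensity, 10 ^ 9, 3, fun t hN k => ?_⟩
  exact_mod_cast abs_diffDensity_sub_gaussian_le hN k
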